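/- Let $n\ge 3$. An $n$-Lie algebra over a field is a vector space $\mathfrak g$ with an alternating $n$-linear bracket satisfying $$[x_1,\dots,x_{n-1},[y_1,\dots,y_n]]=\sum_{i=1}^n[y_1,\dots,[x_1,\dots,x_{n-1},y_i],\dots,y_n].$$ An $n$-Lie module over $\mathfrak g$ is a vector space $M$ together with an extension of the bracket of $\mathfrak g$ to an $n$-Lie algebra bracket on $\mathfrak g\oplus M$ that takes values in $M$ whenever at least one argument lies in $M$ and vanishes whenever at least two arguments lie in $M$. A submodule of $M$ is a subspace $N$ such that the bracket of one element of $N$ (in any position) with $n-1$ elements of $\mathfrak g$ lies in $N$. Let $V_n$ be the simple complex $n$-Lie algebra with basis $e_1,\dots,e_{n+1}$ and bracket $$[e_1,\dots,\widehat{e_i},\dots,e_{n+1}]=(-1)^i e_i\qquad(1\le i\le n+1),$$ where $\widehat{e_i}$ means that $e_i$ is omitted. Then every $2$-dimensional $n$-Lie module $V$ of $V_n$ over $\mathbb C$ is a direct sum $V=V_1\oplus V_2$ of two $1$-dimensional $n$-Lie submodules $V_1,V_2$. -/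

import Mathlib

/-- The structure of an `n`-Lie algebra on a vector space `g`: an alternating `n`-linear bracket
satisfying the generalized Jacobi identity. The identity says that freezing all entries of the
bracket but one gives a derivation of the bracket: with `i` the last position, it reads
`[x₁, …, xₙ₋₁, [y₁, …, yₙ]] = ∑ⱼ [y₁, …, [x₁, …, xₙ₋₁, yⱼ], …, yₙ]`, and for any other position
`i` it is the same identity by antisymmetry (the entry `x i` is not used). -/
structure NLieAlgebra (K : Type*) (n : ℕ) (g : Type*) [Field K] [AddCommGroup g] [Module K g] where
  bracket : g [⋀^Fin n]→ₗ[K] g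
  jacobi : ∀ (x y : Fin n → g) (i : Fin n),
    bracket (Function.update x i (bracket y)) =
      ∑ j, bracket (Function.update y j (bracket (Function.update x i (y j))))

/-- The structure of an `n`-Lie module over the `n`-Lie algebra `L` on a vector space `M`: an
`n`-Lie algebra structure on the semi-direct sum `g ⊕ M` which extends the bracket of `g`, whose
bracket lies in `M` as soon as one argument does, and vanishes as soon as two arguments lie
in `M`. -/
structure NLieModule {K : Type*} {n : ℕ} {g : Type*} [Field K] [AddCommGroup g] [Module K g]
    (L : NLieAlgebra K n g) (M : Type*) [AddCommGroup M] [Module K M] where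
  semidirect : NLieAlgebra K n (g × M)
  bracket_inl : ∀ x : Fin n → g, semidirect.bracket (fun k => (x k, 0)) = (L.bracket x, 0)
  bracket_mem : ∀ (z : Fin n → g × M) (i : Fin n), (z i).1 = 0 → (semidirect.bracket z).1 = 0
  bracket_eq_zero : ∀ (z : Fin n → g × M) (i j : Fin n), i ≠ j → (z i).1 = 0 → (z j).1 = 0 →
    semidirect.bracket z = 0

/-- The element `[x₁, …, xᵢ₋₁, m, xᵢ₊₁, …, xₙ]` of the module `M` (the entry `x i` is not used). -/
def NLieModule.act {K : Type*} {n : ℕ} {g : Type*} [Field K] [AddCommGroup g] [Module K g]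
    {L : NLieAlgebra K n g} {M : Type*} [AddCommGroup M] [Module K M] (ρ : NLieModule L M)
    (x : Fin n → g) (i : Fin n) (m : M) : M :=
  (ρ.semidirect.bracket (Function.update (fun k => (x k, 0)) i (0, m))).2

/-- The subspace `N` of `M` is an `n`-Lie submodule. -/
def NLieModule.IsNLieSubmodule {K : Type*} {n : ℕ} {g : Type*} [Field K] [AddCommGroup g]
    [Module K g] {L : NLieAlgebra K n g} {M : Type*} [AddCommGroup M] [Module K M]
    (ρ : NLieModule L M) (N : Submodule K M) : Prop :=
  ∀ (x : Fin n → g) (i : Fin n), ∀ m ∈ N, ρ.act x i m ∈ N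

/-- The vector product on `ℂⁿ⁺¹`: minus the formal determinant whose first row consists of the
standard basis vectors and whose other rows are `x₁, …, xₙ`. -/
noncomputable def vectorProduct (n : ℕ) : (Fin (n + 1) → ℂ) [⋀^Fin n]→ₗ[ℂ] (Fin (n + 1) → ℂ) :=
  AlternatingMap.pi fun j => -(Matrix.detRowAlternating.curryLeft (Pi.single j 1))

theorem vectorProduct_apply (n : ℕ) (x : Fin n → Fin (n + 1) → ℂ) (j : Fin (n + 1)) :
    vectorProduct n x j = -(Matrix.of (Matrix.vecCons (Pi.single j 1) x)).det := rfl

/-- `[e₁, …, êᵢ, …, eₙ₊₁] = (-1)ⁱ eᵢ`; the index `i : Fin (n + 1)` counts from `0`. -/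
theorem vectorProduct_basis (n : ℕ) (i : Fin (n + 1)) :
    vectorProduct n (fun k => Pi.single (i.succAbove k) 1) =
      (-1 : ℂ) ^ ((i : ℕ) + 1) • Pi.single i 1 := by
  ext j
  rw [vectorProduct_apply]
  by_cases hij : j = i
  · subst hij
    rw [Matrix.det_succ_row_zero, Finset.sum_eq_single j]
    · have : (Matrix.of (Matrix.vecCons (Pi.single j (1 : ℂ))
          (fun k => Pi.single (j.succAbove k) 1))).submatrix Fin.succ j.succAbove = 1 := by
        ext k l
        simp [Matrix.one_apply, Pi.single_apply, eq_comm]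
      rw [this]
      simp [pow_succ]
    · intro k _ hk
      simp [Pi.single_apply, hk]
    · simp
  · obtain ⟨k, rfl⟩ := Fin.exists_succAbove_eq hij
    rw [Matrix.det_zero_of_row_eq (i := 0) (j := k.succ) (Fin.succ_ne_zero k).symm]
    · simp [hij]
    · rfl

theorem sum_det_updateRow {m : Type*} [Fintype m] [DecidableEq m] (z B : Matrix m m ℂ) :
    ∑ j, (z.updateRow j (Matrix.vecMul (z j) B)).det = B.trace * z.det := by
  have h : ∀ j, (z.updateRow j (Matrix.vecMul (z j) B)).det = (z * B * z.adjugate) j j := by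
    intro j
    rw [← Matrix.cramer_transpose_apply, Matrix.cramer_eq_adjugate_mulVec,
      ← Matrix.adjugate_transpose, Matrix.mul_apply]
    simp only [Matrix.mulVec, dotProduct, Matrix.transpose_apply, Matrix.mul_apply,
      Matrix.vecMul]
    exact Finset.sum_congr rfl fun _ _ => mul_comm _ _
  simp only [h]
  change (z * B * z.adjugate).trace = _
  rw [Matrix.trace_mul_comm, ← mul_assoc, Matrix.adjugate_mul]
  simp [mul_comm]

theorem dot_vectorProduct (n : ℕ) (w : Fin (n + 1) → ℂ) (x : Fin n → Fin (n + 1) → ℂ) :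
    w ⬝ᵥ vectorProduct n x = -(Matrix.of (Matrix.vecCons w x)).det := by
  have h : ∀ j, vectorProduct n x j = -((-1) ^ (j : ℕ) *
      (Matrix.submatrix (Matrix.of x) id j.succAbove).det) := by
    intro j
    rw [vectorProduct_apply, Matrix.det_succ_row_zero, Finset.sum_eq_single j]
    · simp [Matrix.submatrix]
    · intro k _ hk
      simp [hk]
    · simp
  rw [Matrix.det_succ_row_zero, dotProduct, ← Finset.sum_neg_distrib]
  refine Finset.sum_congr rfl fun j _ => ?_
  rw [h]
  simp [Matrix.submatrix]
  ring

theorem dot_vectorProduct_update (n : ℕ) (x : Fin n → Fin (n + 1) → ℂ) (i : Fin n)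
    (v : Fin (n + 1) → ℂ) : v ⬝ᵥ vectorProduct n (Function.update x i v) = 0 := by
  rw [dot_vectorProduct, Matrix.det_zero_of_row_eq (i := 0) (j := i.succ)
    (Fin.succ_ne_zero i).symm, neg_zero]
  change v = Function.update x i v i
  simp

theorem vectorProduct_jacobi (n : ℕ) (x y : Fin n → Fin (n + 1) → ℂ) (i : Fin n) :
    vectorProduct n (Function.update x i (vectorProduct n y)) =
      ∑ j, vectorProduct n
        (Function.update y j (vectorProduct n (Function.update x i (y j)))) := by
  let D : (Fin (n + 1) → ℂ) →ₗ[ℂ] (Fin (n + 1) → ℂ) :=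
    (vectorProduct n).toMultilinearMap.toLinearMap x i
  have hD : ∀ v, vectorProduct n (Function.update x i v) = D v := fun _ => rfl
  have hdiag : ∀ v, v ⬝ᵥ D v = 0 := fun v => dot_vectorProduct_update n x i v
  have hskew : ∀ w v, w ⬝ᵥ D v = -(D w ⬝ᵥ v) := by
    intro w v
    have h := hdiag (w + v)
    rw [map_add, add_dotProduct, dotProduct_add, dotProduct_add, hdiag, hdiag,
      dotProduct_comm v] at h
    linear_combination h
  have hB : ∀ v, Matrix.vecMul v (LinearMap.toMatrix' D).transpose = D v := by
    intro v
    rw [Matrix.vecMul_transpose, LinearMap.toMatrix'_mulVec]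
  have htr : (LinearMap.toMatrix' D).transpose.trace = 0 := by
    rw [Matrix.trace_transpose]
    refine Finset.sum_eq_zero fun k _ => ?_
    have := hdiag (Pi.single k 1)
    rw [single_one_dotProduct] at this
    rwa [Matrix.diag_apply, LinearMap.toMatrix'_apply]
  simp only [hD]
  refine dotProduct_eq _ _ fun w => ?_
  rw [dotProduct_comm, dotProduct_comm _ w, hskew, dot_vectorProduct, dotProduct_sum]
  simp only [dot_vectorProduct]
  have key := sum_det_updateRow (Matrix.of (Matrix.vecCons w y)) (LinearMap.toMatrix' D).transpose
  rw [htr, zero_mul, Fin.sum_univ_succ] at key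
  have h0 : (Matrix.of (Matrix.vecCons w y)).updateRow 0
      (Matrix.vecMul (Matrix.of (Matrix.vecCons w y) 0) (LinearMap.toMatrix' D).transpose) =
      Matrix.of (Matrix.vecCons (D w) y) := by
    rw [hB]
    ext a b
    refine Fin.cases ?_ (fun a => ?_) a
    · rw [Matrix.updateRow_self]
      rfl
    · simp [Matrix.updateRow_apply]
  have h1 : ∀ j : Fin n, (Matrix.of (Matrix.vecCons w y)).updateRow j.succ
      (Matrix.vecMul (Matrix.of (Matrix.vecCons w y) j.succ) (LinearMap.toMatrix' D).transpose) =
      Matrix.of (Matrix.vecCons w (Function.update y j (D (y j)))) := by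
    intro j
    rw [hB]
    ext a b
    refine Fin.cases ?_ (fun a => ?_) a
    · simp [Matrix.updateRow_apply, (Fin.succ_ne_zero j).symm]
    · by_cases h : a = j
      · subst h
        rw [Matrix.updateRow_self, Matrix.of_apply, Matrix.cons_val_succ, Function.update_self]
        rfl
      · simp [Matrix.updateRow_apply, h]
  rw [h0] at key
  simp only [h1] at key
  rw [Finset.sum_neg_distrib]
  linear_combination key

/-- The simple complex `n`-Lie algebra `Vₙ`, on `ℂⁿ⁺¹` with its standard basis, with
`[e₁, …, êᵢ, …, eₙ₊₁] = (-1)ⁱ eᵢ`. -/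
noncomputable def simpleNLieAlgebra (n : ℕ) : NLieAlgebra ℂ n (Fin (n + 1) → ℂ) where
  bracket := vectorProduct n
  jacobi := vectorProduct_jacobi n

/-!
The reason for the splitting is that `Vₙ` acts by zero on every two-dimensional module `V`
(`NLieModule.act_eq_zero`), so that every subspace is a submodule and any complement will do.

To see that the action is zero, freeze all entries of the bracket but three. What remains is a
ternary bracket satisfying the Jacobi identity (`ternaryBracket_jacobi`), for which four basis
vectors `g₀, …, g₃` of `Vₙ` span a copy of `V₃` up to a nonzero scalar `δ`. The operators
`T i j = [gᵢ, gⱼ, ·]` on `V` satisfy a relation `[x, ·, [u, v, w]] = ∑ ± T T`, which comes from the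
Jacobi identity with the module element in the outer bracket
(`NLieModule.actHom_ternaryBracket`). It implies that the `T i j` form a representation of
`𝔰𝔬(4) = 𝔰𝔩(2) × 𝔰𝔩(2)` and satisfy in addition
`T₀₁ T₂₃ + T₀₂ T₃₁ + T₀₃ T₁₂ = 0`, which says that the Casimir elements of the two factors
act in the same way.

On a two-dimensional space the two factors cannot both act nontrivially, since the centralizer of a
nonzero traceless `2 × 2` matrix is commutative. So one of them acts by zero; then the Casimir
element of the other one acts by zero as well, and this forces the other factor to act by zero
(`IsCrossTriple.eq_zero_of_commuting_triple`, `Matrix.eq_zero_of_plucker`).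
-/

/-! ### Two commuting `𝔰𝔩(2)`-triples of `2 × 2` matrices -/

/-- Polarized Cayley-Hamilton for traceless `2 × 2` matrices. -/
theorem Matrix.mul_add_mul_eq_trace_smul_one {X Y : Matrix (Fin 2) (Fin 2) ℂ}
    (hX : X.trace = 0) (hY : Y.trace = 0) : X * Y + Y * X = (X * Y).trace • 1 := by
  rw [Matrix.trace_fin_two] at hX hY
  ext i j
  fin_cases i <;> fin_cases j <;>
    simp [Matrix.mul_apply, Matrix.trace_fin_two] <;> grind

/-- The centralizer of a nonzero traceless, hence non-scalar, `2 × 2` matrix is commutative. -/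
theorem Matrix.commute_of_commute_of_trace_eq_zero {A B C : Matrix (Fin 2) (Fin 2) ℂ}
    (hA : A ≠ 0) (htr : A.trace = 0) (hB : Commute A B) (hC : Commute A C) : Commute B C := by
  rw [Matrix.trace_fin_two] at htr
  have hA' : ¬(A 0 0 = 0 ∧ A 0 1 = 0 ∧ A 1 0 = 0) := by
    rintro ⟨h1, h2, h3⟩
    refine hA (Matrix.ext fun i j => ?_)
    fin_cases i <;> fin_cases j <;> simp_all
  have hB' := fun i j => congrFun (congrFun hB.eq i) j
  have hC' := fun i j => congrFun (congrFun hC.eq i) j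
  simp only [Matrix.mul_apply, Fin.sum_univ_two, Fin.forall_fin_two] at hB' hC'
  refine Matrix.ext fun i j => ?_
  fin_cases i <;> fin_cases j <;>
    simp [Matrix.mul_apply] <;> grind

theorem Matrix.trace_eq_zero_of_mul_sub_mul_eq_smul {c : ℂ} (hc : c ≠ 0)
    {X Y Z : Matrix (Fin 2) (Fin 2) ℂ} (h : X * Y - Y * X = c • Z) : Z.trace = 0 := by
  have := congrArg Matrix.trace h
  rw [Matrix.trace_sub, Matrix.trace_mul_comm, sub_self, Matrix.trace_smul, smul_eq_mul] at this
  exact (mul_eq_zero.mp this.symm).resolve_left hc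

/-- The commutation relations `[X, Y] = c Z`, `[Y, Z] = c X`, `[Z, X] = c Y`: up to the scalar `c`,
a representation of `𝔰𝔬(3)` on `ℂ²`. -/
structure IsCrossTriple (c : ℂ) (X Y Z : Matrix (Fin 2) (Fin 2) ℂ) : Prop where
  xy : X * Y - Y * X = c • Z
  yz : Y * Z - Z * Y = c • X
  zx : Z * X - X * Z = c • Y

namespace IsCrossTriple

variable {c : ℂ} {X Y Z : Matrix (Fin 2) (Fin 2) ℂ}

theorem rotate (h : IsCrossTriple c X Y Z) : IsCrossTriple c Y Z X := ⟨h.yz, h.zx, h.xy⟩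

theorem trace_eq_zero (hc : c ≠ 0) (h : IsCrossTriple c X Y Z) : X.trace = 0 :=
  Matrix.trace_eq_zero_of_mul_sub_mul_eq_smul hc h.yz

theorem trace_mul_eq_zero (hc : c ≠ 0) (h : IsCrossTriple c X Y Z) : (X * Y).trace = 0 := by
  have := congrArg (fun A => (A * Y).trace) h.yz
  simp only [sub_mul, Matrix.trace_sub, Matrix.smul_mul, Matrix.trace_smul, smul_eq_mul] at this
  rw [Matrix.trace_mul_cycle Z Y Y, sub_self] at this
  exact (mul_eq_zero.mp this.symm).resolve_left hc

/-- The trace form is invariant, so `X` and `Z` have the same norm. -/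
theorem trace_mul_self (hc : c ≠ 0) (h : IsCrossTriple c X Y Z) :
    (Z * Z).trace = (X * X).trace := by
  have cyc : ((X * Y - Y * X) * Z).trace = (X * (Y * Z - Z * Y)).trace := by
    rw [sub_mul, mul_sub, Matrix.trace_sub, Matrix.trace_sub, ← mul_assoc, ← mul_assoc,
      Matrix.trace_mul_cycle X Z Y]
  rw [h.xy, h.yz, Matrix.smul_mul, Matrix.mul_smul, Matrix.trace_smul, Matrix.trace_smul] at cyc
  exact smul_right_injective ℂ hc cyc

/-- If the Casimir element acts by zero, then so does the whole triple: the members of a triple are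
orthogonal and of equal norm for the trace form, so they anticommute and square to zero. -/
theorem eq_zero_of_sum_sq_eq_zero (hc : c ≠ 0) (h : IsCrossTriple c X Y Z)
    (hsq : X * X + Y * Y + Z * Z = 0) : X = 0 := by
  have tX := h.trace_eq_zero hc
  have tY := h.rotate.trace_eq_zero hc
  have tZ := h.rotate.rotate.trace_eq_zero hc
  have hYY : Y * Y = 0 := by
    have htr : (Y * Y).trace = 0 := by
      have h' := congrArg Matrix.trace hsq
      rw [Matrix.trace_add, Matrix.trace_add, Matrix.trace_zero] at h'
      linear_combination (h' - h.trace_mul_self hc - 2 * h.rotate.trace_mul_self hc) / 3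
    have := Matrix.mul_add_mul_eq_trace_smul_one tY tY
    rw [htr, zero_smul, ← two_smul ℂ] at this
    exact (smul_eq_zero.mp this).resolve_left two_ne_zero
  have hYZ : Y * Z + Z * Y = 0 := by
    rw [Matrix.mul_add_mul_eq_trace_smul_one tY tZ, h.rotate.trace_mul_eq_zero hc, zero_smul]
  have hXY : X * Y + Y * X = 0 := by
    rw [Matrix.mul_add_mul_eq_trace_smul_one tX tY, h.trace_mul_eq_zero hc, zero_smul]
  have h1 : c • X = (2 : ℂ) • (Y * Z) := by
    rw [← h.yz, eq_neg_of_add_eq_zero_right hYZ, two_smul, sub_neg_eq_add]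
  have h2 : c • Z = (-2 : ℂ) • (Y * X) := by
    rw [← h.xy, eq_neg_of_add_eq_zero_left hXY, neg_smul, two_smul]
    abel
  have : (c * c) • X = 0 := by
    rw [mul_smul, h1, smul_comm, ← Matrix.mul_smul, h2, Matrix.mul_smul, ← mul_assoc, hYY]
    simp
  exact (smul_eq_zero.mp this).resolve_left (mul_ne_zero hc hc)

/-- A triple commuting with a non-scalar matrix lies in a commutative algebra, so it vanishes. -/
theorem eq_zero_of_commute (hc : c ≠ 0) {A : Matrix (Fin 2) (Fin 2) ℂ} (hA : A ≠ 0)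
    (htr : A.trace = 0) (h : IsCrossTriple c X Y Z) (hY : Commute A Y) (hZ : Commute A Z) :
    X = 0 := by
  have := h.yz
  rw [(Matrix.commute_of_commute_of_trace_eq_zero hA htr hY hZ).eq, sub_self] at this
  exact (smul_eq_zero.mp this.symm).resolve_left hc

/-- Two commuting triples on `ℂ²` cannot both be nonzero, so if their Casimir elements agree, both
vanish. -/
theorem eq_zero_of_commuting_triple (hc : c ≠ 0) {A B C : Matrix (Fin 2) (Fin 2) ℂ}
    (h : IsCrossTriple c X Y Z) (h' : IsCrossTriple c A B C)
    (hA : Commute X A) (hB : Commute X B) (hC : Commute X C)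
    (hsq : X * X + Y * Y + Z * Z = A * A + B * B + C * C) : X = 0 := by
  by_contra hX
  have tX := h.trace_eq_zero hc
  have hA0 := h'.eq_zero_of_commute hc hX tX hB hC
  have hB0 := h'.rotate.eq_zero_of_commute hc hX tX hC hA
  have hC0 := h'.rotate.rotate.eq_zero_of_commute hc hX tX hA hB
  refine hX (h.eq_zero_of_sum_sq_eq_zero hc ?_)
  simp [hsq, hA0, hB0, hC0]

end IsCrossTriple

/-- Let `T` be the family of operators by which pairs of basis vectors of the four-dimensional
ternary algebra act. The hypotheses `h0`, …, `h3` are the mixed Jacobi identity for the four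
brackets of three distinct basis vectors, the subscript being the index of the value. They contain
both the commutation relations of `𝔰𝔬(4)` and the Plücker relation among the `T i j`. In size two
they force `T 0 1 = 0`. -/
theorem Matrix.eq_zero_of_plucker {δ : ℂ} (hδ : δ ≠ 0)
    (T : Fin 4 → Fin 4 → Matrix (Fin 2) (Fin 2) ℂ)
    (hT : ∀ i j, T i j = -T j i)
    (h0 : ∀ x, T 1 2 * T x 3 + T 2 3 * T x 1 + T 3 1 * T x 2 = -δ • T x 0)
    (h1 : ∀ x, T 3 2 * T x 0 + T 2 0 * T x 3 + T 0 3 * T x 2 = -δ • T x 1)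
    (h2 : ∀ x, T 1 3 * T x 0 + T 3 0 * T x 1 + T 0 1 * T x 3 = -δ • T x 2)
    (h3 : ∀ x, T 1 2 * T x 0 + T 2 0 * T x 1 + T 0 1 * T x 2 = δ • T x 3) : T 0 1 = 0 := by
  have hd (i) : T i i = 0 := by
    have := hT i i
    rw [eq_neg_iff_add_eq_zero, ← two_smul ℂ] at this
    exact (smul_eq_zero.mp this).resolve_left two_ne_zero
  have h10 := hT 1 0
  have h20 := hT 2 0
  have h30 := hT 3 0
  have h21 := hT 2 1
  have h13 := hT 1 3
  have h32 := hT 3 2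
  -- The letters `a`, `b`, `c`, `d` stand for `h0`, `h1`, `h2`, `h3`, followed by the value of `x`.
  have a0 := h0 0
  have a1 := h0 1
  have a2 := h0 2
  have a3 := h0 3
  have b0 := h1 0
  have b1 := h1 1
  have b2 := h1 2
  have b3 := h1 3
  have c0 := h2 0
  have c1 := h2 1
  have c2 := h2 2
  have c3 := h2 3
  have d0 := h3 0
  have d1 := h3 1
  have d2 := h3 2
  have d3 := h3 3
  clear h0 h1 h2 h3
  simp only [hd, h10, h20, h30, h21, h13, h32, mul_zero, smul_zero, zero_add, add_zero,
    neg_mul, mul_neg, smul_neg, neg_smul, neg_neg] at *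
  -- The self-dual and anti-self-dual parts of `𝔰𝔬(4) = 𝔰𝔩(2) × 𝔰𝔩(2)`.
  have hA : IsCrossTriple (2 * δ) (T 0 1 + T 2 3) (T 0 2 + T 3 1) (T 0 3 + T 1 2) := by
    constructor
    · linear_combination (norm := (rw [mul_smul, two_smul, smul_add]; noncomm_ring))
        d0 - c1 + b2 + a3
    · linear_combination (norm := (rw [mul_smul, two_smul, smul_add]; noncomm_ring))
        -b0 + d2 + c3 + a1
    · linear_combination (norm := (rw [mul_smul, two_smul, smul_add]; noncomm_ring))
        -c0 - b3 - d1 + a2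
  have hB : IsCrossTriple (2 * δ) (T 0 1 - T 2 3) (T 0 2 - T 3 1) (T 0 3 - T 1 2) := by
    constructor
    · linear_combination (norm := (rw [mul_smul, two_smul, smul_sub]; noncomm_ring))
        d0 + c1 - b2 + a3
    · linear_combination (norm := (rw [mul_smul, two_smul, smul_sub]; noncomm_ring))
        -b0 - d2 - c3 + a1
    · linear_combination (norm := (rw [mul_smul, two_smul, smul_sub]; noncomm_ring))
        -c0 + b3 + d1 + a2
  have h11 : Commute (T 0 1 + T 2 3) (T 0 1 - T 2 3) := by
    rw [commute_iff_eq]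
    linear_combination (norm := noncomm_ring) a0 + b1 - c2 + d3
  have h12 : Commute (T 0 1 + T 2 3) (T 0 2 - T 3 1) := by
    rw [commute_iff_eq]
    linear_combination (norm := noncomm_ring) d0 + c1 + b2 - a3
  have h13 : Commute (T 0 1 + T 2 3) (T 0 3 - T 1 2) := by
    rw [commute_iff_eq]
    linear_combination (norm := noncomm_ring) c0 - d1 + b3 + a2
  have h21 : Commute (T 0 1 - T 2 3) (T 0 2 + T 3 1) := by
    rw [commute_iff_eq]
    linear_combination (norm := noncomm_ring) d0 - c1 - b2 - a3
  have h31 : Commute (T 0 1 - T 2 3) (T 0 3 + T 1 2) := by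
    rw [commute_iff_eq]
    linear_combination (norm := noncomm_ring) c0 + d1 - b3 + a2
  -- The Plücker relation says that the two Casimir elements agree.
  have hsq : (T 0 1 + T 2 3) * (T 0 1 + T 2 3) + (T 0 2 + T 3 1) * (T 0 2 + T 3 1) +
      (T 0 3 + T 1 2) * (T 0 3 + T 1 2) =
      (T 0 1 - T 2 3) * (T 0 1 - T 2 3) + (T 0 2 - T 3 1) * (T 0 2 - T 3 1) +
      (T 0 3 - T 1 2) * (T 0 3 - T 1 2) := by
    linear_combination (norm := noncomm_ring) a0 + b1 + c2 - d3
  have hc : (2 * δ) ≠ 0 := mul_ne_zero two_ne_zero hδ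
  have hP := hA.eq_zero_of_commuting_triple hc hB h11 h12 h13 hsq
  have hQ := hB.eq_zero_of_commuting_triple hc hA h11.symm h21 h31 hsq.symm
  rw [← sub_eq_zero.mp hQ, ← two_smul ℂ] at hP
  exact (smul_eq_zero.mp hP).resolve_left two_ne_zero

/-! ### Freezing all entries but three -/

section Ternary

variable {K W : Type*} {n : ℕ} [Field K] [AddCommGroup W] [Module K W]

/-- The ternary bracket obtained from an `n`-ary one by letting the entries in the positions
`p`, `q`, `r` vary and freezing all the others to those of `z`. -/
def ternaryBracket (b : W [⋀^Fin n]→ₗ[K] W) (z : Fin n → W) (p q r : Fin n) (u v w : W) : W :=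
  b (Function.update (Function.update (Function.update z p u) q v) r w)

variable {p q r : Fin n}

theorem ternaryBracket_swap_left (hpq : p ≠ q) (hpr : p ≠ r) (hqr : q ≠ r)
    (b : W [⋀^Fin n]→ₗ[K] W) (z : Fin n → W) (u v w : W) :
    ternaryBracket b z p q r v u w = -ternaryBracket b z p q r u v w := by
  rw [ternaryBracket, ternaryBracket, ← b.map_swap _ hpq]
  congr 1
  ext k
  by_cases hk : k = p <;> by_cases hk' : k = q <;> by_cases hk'' : k = r <;>
    simp_all [Function.update_apply, Equiv.swap_apply_of_ne_of_ne]

theorem ternaryBracket_swap_right (hpq : p ≠ q) (hpr : p ≠ r) (hqr : q ≠ r)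
    (b : W [⋀^Fin n]→ₗ[K] W) (z : Fin n → W) (u v w : W) :
    ternaryBracket b z p q r u w v = -ternaryBracket b z p q r u v w := by
  rw [ternaryBracket, ternaryBracket, ← b.map_swap _ hqr]
  congr 1
  ext k
  by_cases hk : k = p <;> by_cases hk' : k = q <;> by_cases hk'' : k = r <;>
    simp_all [Function.update_apply, Equiv.swap_apply_of_ne_of_ne]

/-- Freezing entries of an `n`-Lie bracket preserves the Jacobi identity: the terms of the `n`-ary
identity that would alter a frozen entry contain a bracket with a repeated entry. -/
theorem ternaryBracket_jacobi (hpq : p ≠ q) (hpr : p ≠ r) (hqr : q ≠ r)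
    (L : NLieAlgebra K n W) (z : Fin n → W) (x y u v w : W) :
    ternaryBracket L.bracket z p q r x y (ternaryBracket L.bracket z p q r u v w) =
      ternaryBracket L.bracket z p q r (ternaryBracket L.bracket z p q r x y u) v w +
      ternaryBracket L.bracket z p q r u (ternaryBracket L.bracket z p q r x y v) w +
      ternaryBracket L.bracket z p q r u v (ternaryBracket L.bracket z p q r x y w) := by
  have h := L.jacobi (Function.update (Function.update z p x) q y)
    (Function.update (Function.update (Function.update z p u) q v) r w) r
  rw [← Finset.sum_subset (Finset.subset_univ {p, q, r}),
    Finset.sum_insert (by simp [hpq, hpr]), Finset.sum_pair hqr] at h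
  · simp only [ternaryBracket]
    rw [h, add_assoc]
    simp [Function.update_of_ne, hpq, hpr, hqr, Function.update_comm hpq.symm,
      Function.update_comm hpr.symm, Function.update_comm hqr.symm]
  · intro j _ hj
    simp only [Finset.mem_insert, Finset.mem_singleton, not_or] at hj
    refine L.bracket.map_coord_zero j ?_
    rw [Function.update_self]
    exact L.bracket.map_eq_zero_of_eq _ (by simp [Function.update_of_ne, hj]) hj.2.2

end Ternary

/-! ### Operators on an `n`-Lie module -/

section Module

variable {K g M : Type*} {n : ℕ} [Field K] [AddCommGroup g] [Module K g] [AddCommGroup M]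
  [Module K M] {L : NLieAlgebra K n g}

/-- The endomorphism `m ↦ [x₁, …, xᵢ₋₁, m, xᵢ₊₁, …, xₙ]` of the module (the entry `x i`
is not used). -/
def NLieModule.actHom (ρ : NLieModule L M) (x : Fin n → g) (i : Fin n) : M →ₗ[K] M :=
  LinearMap.snd K g M ∘ₗ
    ρ.semidirect.bracket.toMultilinearMap.toLinearMap (fun k => (x k, 0)) i ∘ₗ LinearMap.inr K g M

theorem NLieModule.actHom_apply (ρ : NLieModule L M) (x : Fin n → g) (i : Fin n) (m : M) :
    ρ.actHom x i m = ρ.act x i m := rfl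

theorem NLieModule.bracket_update (ρ : NLieModule L M) (x : Fin n → g) (i : Fin n) (m : M) :
    ρ.semidirect.bracket (Function.update (fun k => (x k, 0)) i (0, m)) = (0, ρ.actHom x i m) :=
  Prod.ext (ρ.bracket_mem _ i (by simp)) rfl

theorem NLieModule.actHom_update_smul (ρ : NLieModule L M) (x : Fin n → g) {i j : Fin n}
    (hji : j ≠ i) (c : K) (a : g) :
    ρ.actHom (Function.update x j (c • a)) i = c • ρ.actHom (Function.update x j a) i := by
  ext m
  have hupd (a : g) : Function.update (fun k => (Function.update x j a k, (0 : M))) i (0, m) =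
      Function.update (Function.update (fun k => (x k, 0)) i (0, m)) j (a, 0) := by
    rw [Function.update_comm hji.symm]
    congr 1
    ext k <;> simp only [Function.update_apply] <;> split_ifs <;> rfl
  have ha : ((c • a, 0) : g × M) = c • (a, 0) := by simp
  rw [LinearMap.smul_apply, ρ.actHom_apply, ρ.actHom_apply, NLieModule.act, NLieModule.act,
    hupd, hupd, ha, AlternatingMap.map_update_smul, Prod.smul_snd]

theorem NLieModule.ternaryBracket_inl (ρ : NLieModule L M) (x : Fin n → g) (p q r : Fin n)
    (u v w : g) :
    ternaryBracket ρ.semidirect.bracket (fun k => (x k, 0)) p q r (u, 0) (v, 0) (w, 0) =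
      (ternaryBracket L.bracket x p q r u v w, 0) := by
  rw [ternaryBracket, ternaryBracket, ← ρ.bracket_inl]
  congr 1
  ext k <;> simp only [Function.update_apply] <;> split_ifs <;> rfl

theorem NLieModule.ternaryBracket_inr (ρ : NLieModule L M) (x : Fin n → g) (p q r : Fin n)
    (u v : g) (m : M) :
    ternaryBracket ρ.semidirect.bracket (fun k => (x k, 0)) p q r (u, 0) (v, 0) (0, m) =
      (0, ρ.actHom (Function.update (Function.update x p u) q v) r m) := by
  rw [ternaryBracket, ← ρ.bracket_update]
  congr 2
  ext k <;> simp only [Function.update_apply] <;> split_ifs <;> rfl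

variable {p q r : Fin n}

theorem NLieModule.actHom_swap (hpq : p ≠ q) (hpr : p ≠ r) (hqr : q ≠ r)
    (ρ : NLieModule L M) (x : Fin n → g) (u v : g) :
    ρ.actHom (Function.update (Function.update x p u) q v) r =
      -ρ.actHom (Function.update (Function.update x p v) q u) r := by
  ext m
  have := ternaryBracket_swap_left hpq hpr hqr ρ.semidirect.bracket (fun k => (x k, 0))
    (v, 0) (u, 0) (0, m)
  rw [ρ.ternaryBracket_inr, ρ.ternaryBracket_inr] at this
  exact congrArg Prod.snd this

/-- The Jacobi identity with the module element in the outer bracket. It expresses the action of a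
bracket by products of two operators, a relation with no analogue for ordinary Lie modules. -/
theorem NLieModule.actHom_ternaryBracket (hpq : p ≠ q) (hpr : p ≠ r) (hqr : q ≠ r)
    (ρ : NLieModule L M) (z : Fin n → g) (x u v w : g) :
    let T (a b : g) := ρ.actHom (Function.update (Function.update z p a) q b) r
    T v w * T x u + T w u * T x v + T u v * T x w =
      T x (ternaryBracket L.bracket z p q r u v w) := by
  intro T
  ext m
  have h := ternaryBracket_jacobi hpq hpr hqr ρ.semidirect (fun k => (z k, 0))
    (x, 0) (0, m) (u, 0) (v, 0) (w, 0)
  have hneg (m : M) : -((0, m) : g × M) = (0, -m) := by simp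
  have hr (u v : g) (m : M) : ternaryBracket ρ.semidirect.bracket (fun k => (z k, 0)) p q r
      (u, 0) (0, m) (v, 0) = (0, -T u v m) := by
    rw [ternaryBracket_swap_right hpq hpr hqr, ρ.ternaryBracket_inr, hneg]
  have hl (u v : g) (m : M) : ternaryBracket ρ.semidirect.bracket (fun k => (z k, 0)) p q r
      (0, m) (u, 0) (v, 0) = (0, T u v m) := by
    rw [ternaryBracket_swap_left hpq hpr hqr, hr, hneg, neg_neg]
  rw [ρ.ternaryBracket_inl, hr, hr, hr, hr, hl, hr, ρ.ternaryBracket_inr] at h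
  have h2 := congrArg Prod.snd h
  have hs : T w u = -T u w := ρ.actHom_swap hpq hpr hqr z w u
  simp only [Prod.snd_add, map_neg] at h2
  rw [hs]
  simp only [LinearMap.add_apply, Module.End.mul_apply, LinearMap.neg_apply]
  rw [neg_eq_iff_eq_neg.mp h2]
  simp only [neg_add, neg_neg]
  rfl

end Module

/-! ### Brackets of basis vectors of `Vₙ` -/

theorem vectorProduct_perm (n : ℕ) (σ : Equiv.Perm (Fin (n + 1))) (j : Fin (n + 1)) :
    vectorProduct n (fun k => Pi.single (σ k.succ) 1) j =
      -(Equiv.Perm.sign σ : ℂ) * if j = σ 0 then 1 else 0 := by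
  rw [vectorProduct_apply]
  split_ifs with h
  · subst h
    have : Matrix.of (Matrix.vecCons (Pi.single (σ 0) (1 : ℂ))
        fun k => Pi.single (σ k.succ) 1) = (1 : Matrix _ _ ℂ).submatrix σ id := by
      ext a b
      refine Fin.cases ?_ (fun a => ?_) a <;>
        simp [Matrix.one_apply, Pi.single_apply, eq_comm]
    rw [this, Matrix.det_permute]
    simp
  · obtain ⟨i, rfl⟩ := σ.surjective j
    obtain ⟨k, rfl⟩ := Fin.exists_succ_eq.mpr (fun h0 : i = 0 => h (by rw [h0]))
    rw [Matrix.det_zero_of_row_eq (i := 0) (j := k.succ) (Fin.succ_ne_zero k).symm]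
    · simp
    · rfl

theorem vectorProduct_perm_eq (n : ℕ) (σ : Equiv.Perm (Fin (n + 1))) :
    vectorProduct n (fun k => Pi.single (σ k.succ) 1) =
      -(Equiv.Perm.sign σ : ℂ) • Pi.single (σ 0) 1 := by
  ext j
  rw [vectorProduct_perm]
  simp [Pi.single_apply]

/-- The value of the bracket after exchanging one of its entries for the omitted basis vector. -/
theorem vectorProduct_perm_update (n : ℕ) (σ : Equiv.Perm (Fin (n + 1))) (k : Fin n) :
    vectorProduct n (Function.update (fun l => Pi.single (σ l.succ) 1) k (Pi.single (σ 0) 1)) =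
      (Equiv.Perm.sign σ : ℂ) • Pi.single (σ k.succ) 1 := by
  have h := vectorProduct_perm_eq n (σ * Equiv.swap 0 k.succ)
  simp only [Equiv.Perm.mul_apply, Equiv.swap_apply_left, Equiv.Perm.sign_mul,
    Equiv.Perm.sign_swap (Fin.succ_ne_zero k).symm] at h
  convert h using 2
  · ext l
    by_cases hl : l = k
    · subst hl
      simp
    · rw [Function.update_of_ne hl, Equiv.swap_apply_of_ne_of_ne (Fin.succ_ne_zero l)
        (fun h => hl (Fin.succ_injective _ h))]
  · simp

/-! ### Vanishing of the action on two-dimensional modules -/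

theorem Module.End.eq_zero_of_plucker {V : Type*} [AddCommGroup V] [Module ℂ V]
    (hV : Module.finrank ℂ V = 2) {δ : ℂ} (hδ : δ ≠ 0) (T : Fin 4 → Fin 4 → Module.End ℂ V)
    (hT : ∀ i j, T i j = -T j i)
    (h0 : ∀ x, T 1 2 * T x 3 + T 2 3 * T x 1 + T 3 1 * T x 2 = -δ • T x 0)
    (h1 : ∀ x, T 3 2 * T x 0 + T 2 0 * T x 3 + T 0 3 * T x 2 = -δ • T x 1)
    (h2 : ∀ x, T 1 3 * T x 0 + T 3 0 * T x 1 + T 0 1 * T x 3 = -δ • T x 2)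
    (h3 : ∀ x, T 1 2 * T x 0 + T 2 0 * T x 1 + T 0 1 * T x 2 = δ • T x 3) : T 0 1 = 0 := by
  have : Module.Finite ℂ V := Module.finite_of_finrank_pos (by omega)
  let e := LinearMap.toMatrixAlgEquiv (Module.finBasisOfFinrankEq ℂ V hV)
  refine (map_eq_zero_iff e e.injective).mp ?_
  refine Matrix.eq_zero_of_plucker hδ (fun i j => e (T i j)) (fun i j => ?_)
    (fun x => ?_) (fun x => ?_) (fun x => ?_) (fun x => ?_) <;>
    simp only [← map_mul, ← map_add, ← map_smul, ← map_neg, h0, h1, h2, h3]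
  rw [← hT]

section TwoDimensional

variable {n : ℕ} {V : Type*} [AddCommGroup V] [Module ℂ V]

/-- Basis vectors in general position act by zero: together with the omitted vector `e (σ 0)`, the
entries in `r` and two further positions span a four-dimensional ternary algebra. -/
theorem NLieModule.actHom_perm_eq_zero (hn : 3 ≤ n) (hV : Module.finrank ℂ V = 2)
    (ρ : NLieModule (simpleNLieAlgebra n) V) (σ : Equiv.Perm (Fin (n + 1))) (r : Fin n) :
    ρ.actHom (fun k => Pi.single (σ k.succ) 1) r = 0 := by
  obtain ⟨p, hp, q, hq, hpq⟩ := Finset.one_lt_card.mp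
    (show 1 < (Finset.univ.erase r).card by
      rw [Finset.card_erase_of_mem (Finset.mem_univ r), Finset.card_univ, Fintype.card_fin]
      omega)
  have hpr := Finset.ne_of_mem_erase hp
  have hqr := Finset.ne_of_mem_erase hq
  set z : Fin n → Fin (n + 1) → ℂ := fun k => Pi.single (σ k.succ) 1
  set t : Fin (n + 1) → ℂ := Pi.single (σ 0) 1
  let G : Fin 4 → Fin (n + 1) → ℂ := ![z p, z q, z r, t]
  let T (a b : Fin (n + 1) → ℂ) : Module.End ℂ V :=
    ρ.actHom (Function.update (Function.update z p a) q b) r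
  have hsmul (a b : Fin (n + 1) → ℂ) (c : ℂ) : T a (c • b) = c • T a b :=
    ρ.actHom_update_smul _ hqr c b
  have hupd := vectorProduct_perm_update n σ
  have key := fun x => ρ.actHom_ternaryBracket hpq hpr hqr z (G x)
  have b3 : ternaryBracket (simpleNLieAlgebra n).bracket z p q r (z p) (z q) (z r) =
      -(Equiv.Perm.sign σ : ℂ) • t := by
    simp only [ternaryBracket, Function.update_eq_self]
    exact vectorProduct_perm_eq n σ
  have b0 : ternaryBracket (simpleNLieAlgebra n).bracket z p q r t (z q) (z r) =
      -(-(Equiv.Perm.sign σ : ℂ)) • z p := by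
    rw [neg_neg, ← hupd p]
    simp [ternaryBracket, Function.update_comm hpq, Function.update_comm hpr]
    rfl
  have b1 : ternaryBracket (simpleNLieAlgebra n).bracket z p q r (z p) t (z r) =
      -(-(Equiv.Perm.sign σ : ℂ)) • z q := by
    rw [neg_neg, ← hupd q]
    simp [ternaryBracket, Function.update_comm hqr]
    rfl
  have b2 : ternaryBracket (simpleNLieAlgebra n).bracket z p q r (z p) (z q) t =
      -(-(Equiv.Perm.sign σ : ℂ)) • z r := by
    rw [neg_neg, ← hupd r]
    simp [ternaryBracket]
    rfl
  have main : T (z p) (z q) = 0 := by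
    refine Module.End.eq_zero_of_plucker hV (δ := -(Equiv.Perm.sign σ : ℂ)) (by simp)
      (fun i j => T (G i) (G j)) (fun i j => ρ.actHom_swap hpq hpr hqr z _ _)
      (fun x => ?_) (fun x => ?_) (fun x => ?_) (fun x => ?_)
    · exact (key x t (z q) (z r)).trans (by rw [b0]; exact hsmul _ _ _)
    · exact (key x (z p) t (z r)).trans (by rw [b1]; exact hsmul _ _ _)
    · exact (key x (z p) (z q) t).trans (by rw [b2]; exact hsmul _ _ _)
    · exact (key x (z p) (z q) (z r)).trans (by rw [b3]; exact hsmul _ _ _)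
  simpa [T] using main

/-- The simple `n`-Lie algebra acts by zero on every two-dimensional module. -/
theorem NLieModule.act_eq_zero (hn : 3 ≤ n) (hV : Module.finrank ℂ V = 2)
    (ρ : NLieModule (simpleNLieAlgebra n) V) (x : Fin n → Fin (n + 1) → ℂ) (i : Fin n) (m : V) :
    ρ.act x i m = 0 := by
  have hbasis (f : Fin n → Fin (n + 1)) : ρ.act (fun k => Pi.single (f k) 1) i m = 0 := by
    -- The entry `f i` is not used, so only the restriction of `f` to the other positions matters.
    by_cases hf : Set.InjOn f {k | k ≠ i}
    · obtain ⟨σ, hσ⟩ := Set.MapsTo.exists_equiv_extend_of_card_eq (α := Fin (n + 1))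
        (t := Finset.univ) (by simp) (s := Fin.succ '' {k | k ≠ i})
        (f := Fin.cases 0 f) (by simp [Set.MapsTo]) (by
          rintro _ ⟨a, ha, rfl⟩ _ ⟨b, hb, rfl⟩ hab
          exact congrArg _ (hf ha hb hab))
      have h := LinearMap.congr_fun (ρ.actHom_perm_eq_zero hn hV
        (σ.trans (Equiv.subtypeUnivEquiv Finset.mem_univ)) i) m
      refine Eq.trans ?_ h
      rw [NLieModule.actHom_apply, NLieModule.act, NLieModule.act]
      congr 2
      ext1 k
      by_cases hk : k = i
      · subst hk; simp
      · rw [Function.update_of_ne hk, Function.update_of_ne hk]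
        simp [hσ k.succ ⟨k, hk, rfl⟩]
    · simp only [Set.InjOn, not_forall] at hf
      obtain ⟨a, ha, b, hb, hab, hne⟩ := hf
      rw [NLieModule.act, AlternatingMap.map_eq_zero_of_eq _ _ ?_ hne]
      · rfl
      · rw [Function.update_of_ne ha, Function.update_of_ne hb, hab]
  -- `x ↦ ρ.act x i m` ignores `x i`, so it is not multilinear. Multiplying it by the linear form `s`
  -- of `x i`, which is `1` on each basis vector, makes it multilinear with the same values there.
  let s : (Fin (n + 1) → ℂ) →ₗ[ℂ] ℂ := ∑ j, LinearMap.proj j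
  let ℓ (k : Fin n) : (Fin (n + 1) → ℂ) →ₗ[ℂ] (Fin (n + 1) → ℂ) × V :=
    if k = i then LinearMap.inr ℂ _ V ∘ₗ s.smulRight m else LinearMap.inl ℂ _ V
  have hℓ (y : Fin n → Fin (n + 1) → ℂ) (hy : s (y i) = 1) :
      (fun k => ℓ k (y k)) = Function.update (fun k => (y k, 0)) i (0, m) := by
    ext1 k
    by_cases hk : k = i
    · subst hk; simp [ℓ, hy]
    · simp [ℓ, hk]
  have hzero : (LinearMap.snd ℂ _ V).compMultilinearMap
      (ρ.semidirect.bracket.toMultilinearMap.compLinearMap ℓ) = 0 := by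
    refine Module.Basis.ext_multilinear (fun _ => Pi.basisFun ℂ (Fin (n + 1))) fun f => ?_
    simp only [Pi.basisFun_apply]
    have := hbasis f
    rw [NLieModule.act, ← hℓ _ (by simp [s, Pi.single_apply])] at this
    exact this
  have h := congrArg (fun F => F (Function.update x i (Pi.single i.succ 1))) hzero
  have h' : (ρ.semidirect.bracket
      fun k => ℓ k (Function.update x i (Pi.single i.succ 1) k)).2 = 0 := h
  rw [hℓ _ (by simp [s, Pi.single_apply])] at h'
  rw [← h', NLieModule.act]
  congr 2
  ext1 k
  by_cases hk : k = i
  · subst hk; simp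
  · simp [hk]

end TwoDimensional

theorem corollary3p3 (n : ℕ) (hn : 3 ≤ n) {V : Type*} [AddCommGroup V] [Module ℂ V]
    (hV : Module.finrank ℂ V = 2) (ρ : NLieModule (simpleNLieAlgebra n) V) :
    ∃ V₁ V₂ : Submodule ℂ V, ρ.IsNLieSubmodule V₁ ∧ ρ.IsNLieSubmodule V₂ ∧
      Module.finrank ℂ V₁ = 1 ∧ Module.finrank ℂ V₂ = 1 ∧ IsCompl V₁ V₂ := by
  have hsub (N : Submodule ℂ V) : ρ.IsNLieSubmodule N := fun x i m _ => by
    rw [ρ.act_eq_zero hn hV]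
    exact N.zero_mem
  have : Module.Finite ℂ V := Module.finite_of_finrank_pos (by omega)
  have : Nontrivial V := Module.nontrivial_of_finrank_pos (R := ℂ) (by omega)
  obtain ⟨v, hv⟩ := exists_ne (0 : V)
  obtain ⟨V₂, h⟩ := (Submodule.span ℂ {v}).exists_isCompl
  have h1 := finrank_span_singleton (K := ℂ) hv
  have h2 := Submodule.finrank_add_eq_of_isCompl h
  exact ⟨_, V₂, hsub _, hsub _, h1, by omega, h⟩
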